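/- Let $A$ be a (not necessarily unital) $C^*$-algebra. Hilbert $A$-modules are right Hilbert $A$-modules: complete, with an $A$-valued inner product $\langle\cdot,\cdot\rangle$ that is $A$-linear in the second variable. For Hilbert $A$-modules $E,F$, let $B(E,F)$ be the set of all bounded (complex-linear) $A$-module maps $E\to F$, with or without adjoints. For a Hilbert $A$-module $H$, let $K(H)$ be the norm closure of the linear span of the maps $x\mapsto \xi\langle\zeta,x\rangle$, $\xi,\zeta\in H$. Suppose that $H$ is a Hilbert $A$-module for which the algebra $K(H)$ has an identity. Then $H$ is projective in the category of Hilbert $A$-modules with all bounded module maps as morphisms, that is: (1) for every Hilbert $A$-module $H_1$ and every surjective $S\in B(H_1,H)$ there is $L\in B(H,H_1)$ with $S\circ L=\mathrm{id}_H$; (2) for all Hilbert $A$-modules $H_1,H_2$, every surjective $S\in B(H_1,H_2)$ and every $\varphi\in B(H,H_2)$ there is $L\in B(H,H_1)$ with $S\circ L=\varphi$. -/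

import Mathlib

open MulOpposite
open scoped RightActions

universe u v w₁ w₂

namespace HilbertMod

/- Throughout, a Hilbert module over a (not necessarily unital) C⋆-algebra `A` is a *right* Hilbert
`A`-module: a complex Banach space `E` with a right action `x <• a` of `A` (that is, an action of
`Aᵐᵒᵖ`) and an instance of Mathlib's `CStarModule Aᵐᵒᵖ E`. Mathlib's class is written for left
actions, with an inner product that is linear in the second variable; over `Aᵐᵒᵖ` it becomes the
usual notion of a right Hilbert `A`-module, as `rinner` and the lemmas after it show. The norm of
`E` is the one given by the inner product: this is an axiom of `CStarModule`. -/

section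

variable {A : Type u} [NonUnitalCStarAlgebra A] [PartialOrder A] [StarOrderedRing A]
  {E : Type v} [NormedAddCommGroup E] [NormedSpace ℂ E] [SMul Aᵐᵒᵖ E] [CStarModule Aᵐᵒᵖ E]

variable (A) in
/-- The `A`-valued inner product `⟨x, y⟩` of a right Hilbert `A`-module: conjugate linear in `x`,
linear in `y`. -/
def rinner (x y : E) : A := unop (inner Aᵐᵒᵖ x y)

theorem rinner_smul_right (x y : E) (a : A) : rinner A x (y <• a) = rinner A x y * a := by
  simp [rinner]

theorem star_rinner (x y : E) : star (rinner A x y) = rinner A y x := by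
  rw [rinner, ← unop_star, CStarModule.star_inner]; rfl

theorem rinner_smul_left (x y : E) (a : A) : rinner A (x <• a) y = star a * rinner A x y := by
  rw [← star_rinner, rinner_smul_right, star_mul, star_rinner]

theorem rinner_self_nonneg (x : E) : 0 ≤ rinner A x x :=
  (CStarModule.inner_self_nonneg (A := Aᵐᵒᵖ) (x := x) :)

theorem rinner_add_right (x y z : E) : rinner A x (y + z) = rinner A x y + rinner A x z := by
  simp [rinner]

theorem rinner_smul_complex_right (c : ℂ) (x y : E) :
    rinner A x (c • y) = c • rinner A x y := by
  simp [rinner]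

theorem norm_sq_eq (x : E) : ‖x‖ ^ 2 = ‖rinner A x x‖ := by
  rw [CStarModule.norm_sq_eq Aᵐᵒᵖ]; rfl

theorem norm_rinner_le (x y : E) : ‖rinner A x y‖ ≤ ‖x‖ * ‖y‖ :=
  (CStarModule.norm_inner_le (A := Aᵐᵒᵖ) E (x := x) (y := y) :)

variable (A) in
theorem ext_rinner {x y : E} (h : ∀ z : E, rinner A z x = rinner A z y) : x = y := by
  have h0 : inner Aᵐᵒᵖ (x - y) (x - y) = 0 := by
    rw [CStarModule.inner_sub_right, sub_eq_zero]
    exact unop_injective (h (x - y))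
  exact sub_eq_zero.mp (CStarModule.inner_self.mp h0)

theorem smul_add_right (x y : E) (a : A) : (x + y) <• a = x <• a + y <• a :=
  ext_rinner A fun z => by simp only [rinner_smul_right, rinner_add_right, add_mul]

theorem add_smul_right (x : E) (a b : A) : x <• (a + b) = x <• a + x <• b :=
  ext_rinner A fun z => by simp only [rinner_smul_right, rinner_add_right, mul_add]

theorem smul_complex_smul_right (c : ℂ) (x : E) (a : A) : (c • x) <• a = c • (x <• a) :=
  ext_rinner A fun z => by
    simp only [rinner_smul_right, rinner_smul_complex_right, smul_mul_assoc]

theorem smul_right_complex_smul (c : ℂ) (x : E) (a : A) : x <• (c • a) = c • (x <• a) :=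
  ext_rinner A fun z => by
    simp only [rinner_smul_right, rinner_smul_complex_right, mul_smul_comm]

theorem norm_smul_right_le (x : E) (a : A) : ‖x <• a‖ ≤ ‖x‖ * ‖a‖ := by
  refine le_of_sq_le_sq ?_ (by positivity)
  calc ‖x <• a‖ ^ 2 = ‖star a * rinner A x x * a‖ := by
        rw [norm_sq_eq (A := A), rinner_smul_right, rinner_smul_left]
    _ ≤ ‖star a * rinner A x x‖ * ‖a‖ := norm_mul_le _ _
    _ ≤ ‖star a‖ * ‖rinner A x x‖ * ‖a‖ := by gcongr; exact norm_mul_le _ _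
    _ = (‖x‖ * ‖a‖) ^ 2 := by rw [norm_star, ← norm_sq_eq]; ring

variable (A) in
/-- The rank one module map `ξ⟨ζ, -⟩`, that is `x ↦ ξ⟨ζ, x⟩`, as a bounded operator. -/
noncomputable def rankOne (ξ ζ : E) : E →L[ℂ] E :=
  LinearMap.mkContinuous
    { toFun := fun x => ξ <• rinner A ζ x
      map_add' := fun x y => by rw [rinner_add_right, add_smul_right]
      map_smul' := fun c x => by
        rw [rinner_smul_complex_right, smul_right_complex_smul]; rfl }
    (‖ξ‖ * ‖ζ‖) fun x => by
      calc ‖ξ <• rinner A ζ x‖ ≤ ‖ξ‖ * ‖rinner A ζ x‖ := norm_smul_right_le _ _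
        _ ≤ ‖ξ‖ * (‖ζ‖ * ‖x‖) := by gcongr; exact norm_rinner_le _ _
        _ = ‖ξ‖ * ‖ζ‖ * ‖x‖ := by ring

@[simp]
theorem rankOne_apply (ξ ζ x : E) : rankOne A ξ ζ x = ξ <• rinner A ζ x := rfl

end

section

variable (A : Type u) [NonUnitalCStarAlgebra A] [PartialOrder A] [StarOrderedRing A]
  (H : Type v) [NormedAddCommGroup H] [NormedSpace ℂ H] [SMul Aᵐᵒᵖ H] [CStarModule Aᵐᵒᵖ H]

/-- `F(H)`: the linear span of the module maps `ξ⟨ζ, -⟩` with `ξ, ζ ∈ H`. -/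
noncomputable def finiteRank : Submodule ℂ (H →L[ℂ] H) :=
  Submodule.span ℂ (Set.range fun p : H × H => rankOne A p.1 p.2)

/-- `K(H)`: the closure of `F(H)` in the operator norm. -/
noncomputable def compactOps : Submodule ℂ (H →L[ℂ] H) :=
  (finiteRank A H).topologicalClosure

/-- The algebra `K(H)` (with composition as its product) has an identity element. -/
def CompactOpsUnital : Prop :=
  ∃ e ∈ compactOps A H, ∀ T ∈ compactOps A H, e ∘L T = T ∧ T ∘L e = T

end

section

variable (A : Type u) [NonUnitalCStarAlgebra A]

/-- `B(E, F)`: the space of all bounded `A`-module maps from `E` to `F`; they need not have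
adjoints. -/
def moduleMaps (E : Type w₁) [NormedAddCommGroup E] [NormedSpace ℂ E] [SMul Aᵐᵒᵖ E]
    (F : Type w₂) [NormedAddCommGroup F] [NormedSpace ℂ F] [SMul Aᵐᵒᵖ F] :
    Set (E →L[ℂ] F) :=
  {T | ∀ (x : E) (a : A), T (x <• a) = T x <• a}

/-- `H` is projective in the category of Hilbert `A`-modules with all bounded module maps as
morphisms: every surjective bounded module map onto `H` has a right inverse that is a bounded
module map, and bounded module maps from `H` lift through surjective bounded module maps. The test
modules range over arbitrary universes. -/
structure IsProjective [PartialOrder A] [StarOrderedRing A] (H : Type v) [NormedAddCommGroup H]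
    [NormedSpace ℂ H] [SMul Aᵐᵒᵖ H] [CStarModule Aᵐᵒᵖ H] : Prop where
  splits : ∀ (H₁ : Type w₁) [NormedAddCommGroup H₁] [NormedSpace ℂ H₁] [CompleteSpace H₁]
    [SMul Aᵐᵒᵖ H₁] [CStarModule Aᵐᵒᵖ H₁],
    ∀ S ∈ moduleMaps A H₁ H, Function.Surjective S →
      ∃ L ∈ moduleMaps A H H₁, S ∘L L = ContinuousLinearMap.id ℂ H
  lifts : ∀ (H₁ : Type w₁) [NormedAddCommGroup H₁] [NormedSpace ℂ H₁] [CompleteSpace H₁]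
    [SMul Aᵐᵒᵖ H₁] [CStarModule Aᵐᵒᵖ H₁]
    (H₂ : Type w₂) [NormedAddCommGroup H₂] [NormedSpace ℂ H₂] [CompleteSpace H₂]
    [SMul Aᵐᵒᵖ H₂] [CStarModule Aᵐᵒᵖ H₂],
    ∀ S ∈ moduleMaps A H₁ H₂, Function.Surjective S →
      ∀ φ ∈ moduleMaps A H H₂, ∃ L ∈ moduleMaps A H H₁, S ∘L L = φ

end

end HilbertMod

namespace HilbertMod

section

variable {A : Type u} [NonUnitalCStarAlgebra A] [PartialOrder A] [StarOrderedRing A]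
  {E : Type v} [NormedAddCommGroup E] [NormedSpace ℂ E] [SMul Aᵐᵒᵖ E] [CStarModule Aᵐᵒᵖ E]
  {F : Type w₁} [NormedAddCommGroup F] [NormedSpace ℂ F] [SMul Aᵐᵒᵖ F] [CStarModule Aᵐᵒᵖ F]
  {G : Type w₂} [NormedAddCommGroup G] [NormedSpace ℂ G] [SMul Aᵐᵒᵖ G] [CStarModule Aᵐᵒᵖ G]

/-! An identity of `K(H)` must be the identity operator (`id_mem_compactOps`), so `id` is a norm
limit of finite sums `∑ ξᵢ⟨ζᵢ, -⟩`. One such sum `U` lies within distance 1 of `id` and is therefore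
invertible (`exists_unit_mem_finiteRank`). Given a surjection `S` and a map `φ`, choosing `ηᵢ` with
`S ηᵢ = φ ξᵢ` makes `L = ∑ ηᵢ⟨ζᵢ, -⟩` a lift of `φ ∘ U` (`exists_lift_comp_finiteRank`), and `L ∘
U⁻¹` lifts `φ`. No adjoint of `S` or `φ` is needed. -/

theorem smul_mul_right (x : E) (a b : A) : x <• (a * b) = (x <• a) <• b :=
  ext_rinner A fun z => by simp only [rinner_smul_right, mul_assoc]

theorem zero_smul_right (a : A) : (0 : E) <• a = 0 := by
  have h := smul_add_right (0 : E) 0 a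
  rwa [add_zero, left_eq_add] at h

theorem sub_smul_right (x y : E) (a : A) : (x - y) <• a = x <• a - y <• a := by
  rw [eq_sub_iff_add_eq, ← smul_add_right, sub_add_cancel]

theorem continuous_smul_right (a : A) : Continuous fun x : E => x <• a := by
  refine (LipschitzWith.of_dist_le_mul (K := ‖a‖₊) fun x y => ?_).continuous
  rw [dist_eq_norm, dist_eq_norm, ← sub_smul_right, mul_comm]
  exact norm_smul_right_le _ _

/-- Pairing the hypothesis with `x` gives `⟨x, x⟩² = 0`, and `⟨x, x⟩` is self-adjoint, so the
C⋆-identity applies. -/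
theorem eq_zero_of_smul_rinner_self {x : E} (h : x <• rinner A x x = 0) : x = 0 := by
  have h1 : star (rinner A x x) * rinner A x x = 0 := by
    rw [star_rinner, ← rinner_smul_right, h]
    simp [rinner]
  rw [CStarRing.star_mul_self_eq_zero_iff] at h1
  have h2 := norm_sq_eq (A := A) x
  rw [h1, norm_zero] at h2
  exact norm_eq_zero.mp (pow_eq_zero_iff two_ne_zero |>.mp h2)

variable (A E F) in
/-- The bounded module maps, as a linear subspace of the bounded operators. -/
def moduleMapsSubmodule : Submodule ℂ (E →L[ℂ] F) where
  carrier := moduleMaps A E F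
  zero_mem' x a := (zero_smul_right a).symm
  add_mem' {S T} hS hT x a := by
    rw [add_apply, add_apply, smul_add_right, hS, hT]
  smul_mem' c T hT x a := by
    rw [smul_apply, smul_apply, smul_complex_smul_right, hT]

/-- Each condition `T (xa) = (T x)a` equates two continuous functions of `T`. Closedness passes
`A`-linearity from finite rank operators to their norm limits. -/
theorem isClosed_moduleMaps : IsClosed (moduleMaps A E F) := by
  simp only [moduleMaps, Set.ofPred_forall]
  refine isClosed_iInter fun x => isClosed_iInter fun a => ?_
  exact isClosed_eq (ContinuousLinearMap.apply ℂ F (x <• a)).continuous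
    ((continuous_smul_right a).comp (ContinuousLinearMap.apply ℂ F x).continuous)

theorem comp_mem_moduleMaps {S : F →L[ℂ] G} {T : E →L[ℂ] F} (hS : S ∈ moduleMaps A F G)
    (hT : T ∈ moduleMaps A E F) : S ∘L T ∈ moduleMaps A E G := fun x a => by
  rw [ContinuousLinearMap.comp_apply, hT, hS, ContinuousLinearMap.comp_apply]

theorem inv_mem_moduleMaps (U : (E →L[ℂ] E)ˣ) (hU : (U : E →L[ℂ] E) ∈ moduleMaps A E E) :
    (↑U⁻¹ : E →L[ℂ] E) ∈ moduleMaps A E E := fun x a => by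
  have h1 (y : E) : (↑U⁻¹ : E →L[ℂ] E) ((U : E →L[ℂ] E) y) = y :=
    DFunLike.congr_fun U.inv_mul y
  have h2 (y : E) : (U : E →L[ℂ] E) ((↑U⁻¹ : E →L[ℂ] E) y) = y :=
    DFunLike.congr_fun U.mul_inv y
  rw [← h1 ((↑U⁻¹ : E →L[ℂ] E) x <• a), hU, h2]

variable (A) in
/-- The rank one module map `η⟨ζ, -⟩` between two Hilbert modules. -/
noncomputable def rankOneTo (η : F) (ζ : E) : E →L[ℂ] F :=
  LinearMap.mkContinuous
    { toFun := fun x => η <• rinner A ζ x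
      map_add' := fun x y => by rw [rinner_add_right, add_smul_right]
      map_smul' := fun c x => by
        rw [rinner_smul_complex_right, smul_right_complex_smul]; rfl }
    (‖η‖ * ‖ζ‖) fun x => by
      calc ‖η <• rinner A ζ x‖ ≤ ‖η‖ * ‖rinner A ζ x‖ := norm_smul_right_le _ _
        _ ≤ ‖η‖ * (‖ζ‖ * ‖x‖) := by gcongr; exact norm_rinner_le _ _
        _ = ‖η‖ * ‖ζ‖ * ‖x‖ := by ring

@[simp]
theorem rankOneTo_apply (η : F) (ζ x : E) : rankOneTo A η ζ x = η <• rinner A ζ x := rfl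

theorem rankOneTo_mem_moduleMaps (η : F) (ζ : E) : rankOneTo A η ζ ∈ moduleMaps A E F :=
  fun x a => by rw [rankOneTo_apply, rankOneTo_apply, rinner_smul_right, smul_mul_right]

theorem finiteRank_le_moduleMaps : finiteRank A E ≤ moduleMapsSubmodule A E E := by
  refine Submodule.span_le.mpr ?_
  rintro _ ⟨p, rfl⟩
  -- `rankOne` is definitionally `rankOneTo` with equal source and target.
  exact rankOneTo_mem_moduleMaps p.1 p.2

theorem compactOps_le_moduleMaps : compactOps A E ≤ moduleMapsSubmodule A E E :=
  Submodule.topologicalClosure_minimal _ finiteRank_le_moduleMaps isClosed_moduleMaps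

/-- An identity element of `K(E)` is the identity operator. -/
theorem id_mem_compactOps (h : CompactOpsUnital A E) :
    ContinuousLinearMap.id ℂ E ∈ compactOps A E := by
  obtain ⟨e, he, hid⟩ := h
  have hmod : e ∈ moduleMaps A E E := compactOps_le_moduleMaps he
  suffices e = ContinuousLinearMap.id ℂ E from this ▸ he
  ext ξ
  refine sub_eq_zero.mp (eq_zero_of_smul_rinner_self (A := A) ?_)
  -- The defect `y = e ξ - ξ` is itself the test vector: `e ∘ T = T` for `T = ξ⟨y, -⟩`, evaluated at
  -- `y`, yields `y⟨y, y⟩ = 0`.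
  set y := e ξ - ContinuousLinearMap.id ℂ E ξ
  have hT : rankOne A ξ y ∈ compactOps A E :=
    Submodule.le_topologicalClosure _ (Submodule.subset_span ⟨(ξ, y), rfl⟩)
  have h1 : e (ξ <• rinner A y y) = ξ <• rinner A y y := DFunLike.congr_fun (hid _ hT).1 y
  rw [hmod] at h1
  change (e ξ - ξ) <• rinner A y y = 0
  rw [sub_smul_right, h1, sub_self]

/-- If `K(E)` is unital, then some operator of finite rank is invertible. -/
theorem exists_unit_mem_finiteRank [CompleteSpace E] (h : CompactOpsUnital A E) :
    ∃ U : (E →L[ℂ] E)ˣ, (U : E →L[ℂ] E) ∈ finiteRank A E := by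
  obtain ⟨T, hT, hd⟩ := Metric.mem_closure_iff.mp (id_mem_compactOps h) 1 one_pos
  rw [dist_eq_norm] at hd
  -- Neumann series: `T = 1 - (1 - T)` with `‖1 - T‖ < 1`.
  exact ⟨Units.oneSub (ContinuousLinearMap.id ℂ E - T) hd, by
    rw [Units.val_oneSub]; exact (sub_sub_cancel (1 : E →L[ℂ] E) T).symm ▸ hT⟩

/-- Only finitely many vectors have to be lifted through `S`, so arbitrary preimages suffice, with
no control on their norms. -/
theorem exists_lift_comp_finiteRank {S : F →L[ℂ] G} (hS : S ∈ moduleMaps A F G)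
    (hsurj : Function.Surjective S) {φ : E →L[ℂ] G} (hφ : φ ∈ moduleMaps A E G)
    {T : E →L[ℂ] E} (hT : T ∈ finiteRank A E) :
    ∃ L ∈ moduleMapsSubmodule A E F, S ∘L L = φ ∘L T := by
  induction hT using Submodule.span_induction with
  | mem T hT =>
    obtain ⟨⟨ξ, ζ⟩, rfl⟩ := hT
    obtain ⟨η, hη⟩ := hsurj (φ ξ)
    refine ⟨rankOneTo A η ζ, rankOneTo_mem_moduleMaps η ζ, ?_⟩
    ext x
    simp only [ContinuousLinearMap.comp_apply, rankOneTo_apply, rankOne_apply]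
    rw [hS, hφ, hη]
  | zero => exact ⟨0, zero_mem _, by simp⟩
  | add T T' _ _ h h' =>
    obtain ⟨L, hL, hSL⟩ := h
    obtain ⟨L', hL', hSL'⟩ := h'
    exact ⟨L + L', add_mem hL hL', by
      rw [ContinuousLinearMap.comp_add, ContinuousLinearMap.comp_add, hSL, hSL']⟩
  | smul c T _ h =>
    obtain ⟨L, hL, hSL⟩ := h
    exact ⟨c • L, Submodule.smul_mem _ c hL, by
      rw [ContinuousLinearMap.comp_smul, ContinuousLinearMap.comp_smul, hSL]⟩

theorem exists_lift [CompleteSpace E] (h : CompactOpsUnital A E) {S : F →L[ℂ] G}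
    (hS : S ∈ moduleMaps A F G) (hsurj : Function.Surjective S) {φ : E →L[ℂ] G}
    (hφ : φ ∈ moduleMaps A E G) : ∃ L ∈ moduleMaps A E F, S ∘L L = φ := by
  obtain ⟨U, hU⟩ := exists_unit_mem_finiteRank h
  obtain ⟨L, hL, hSL⟩ := exists_lift_comp_finiteRank hS hsurj hφ hU
  refine ⟨L ∘L (↑U⁻¹ : E →L[ℂ] E),
    comp_mem_moduleMaps hL (inv_mem_moduleMaps U (finiteRank_le_moduleMaps hU)), ?_⟩
  rw [← ContinuousLinearMap.comp_assoc, hSL, ContinuousLinearMap.comp_assoc]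
  exact (congrArg (φ ∘L ·) U.mul_inv).trans (ContinuousLinearMap.comp_id φ)

end

end HilbertMod

theorem proposition3p7 (A : Type u) [NonUnitalCStarAlgebra A] [PartialOrder A] [StarOrderedRing A]
    (H : Type v) [NormedAddCommGroup H] [NormedSpace ℂ H] [CompleteSpace H]
    [SMul Aᵐᵒᵖ H] [CStarModule Aᵐᵒᵖ H]
    (hH : HilbertMod.CompactOpsUnital A H) :
    HilbertMod.IsProjective.{u, v, w₁, w₂} A H := by
  constructor
  · intro _ _ _ _ _ _ S hS hsurj
    -- A right inverse of `S` is a lift of the identity map.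
    exact HilbertMod.exists_lift hH hS hsurj fun _ _ => rfl
  · intro _ _ _ _ _ _ _ _ _ _ _ _ S hS hsurj φ hφ
    exact HilbertMod.exists_lift hH hS hsurj hφ
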